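/- Let $\mathcal M$ be an $M$-dimensional $C^2$ manifold and let $G$ be a Lie subgroup of $\mathrm{Gl}(L,\mathbb R)$, with (smooth, injective, immersive) inclusion homomorphism $\iota: G\to \mathrm{Gl}(L,\mathbb R)$. Let $\Gamma_G := \iota^*(z^{-1}dz)$ be its Maurer-Cartan form, where $z=(z_{ij})$ are the coordinates of $\mathrm{Gl}(L,\mathbb R)$, so that $z^{-1}dz$ is the matrix of $1$-forms with entries $\sum_q (z^{-1})_{iq}\,dz_{qj}$. Let $\varphi=(\varphi^{(ij)})$ be an $L\times L$ matrix of differential $1$-forms of class $C^1$ on $\mathcal M$. Exterior derivative and pullback of matrix-valued forms are taken entrywise, and $(\varphi\wedge\varphi)^{(ij)}:=\sum_{q=1}^L \varphi^{(iq)}\wedge\varphi^{(qj)}$. Let $\mathcal U\subset\mathcal M$ be open, let $f:\mathcal U\to G$ be a map of class $C^1$, and set $$\mathcal E := \{P\in\mathcal U \mid (f^*\Gamma_G)_P=\varphi_P\}.$$ Then $(d\varphi)_Q = -(\varphi\wedge\varphi)_Q$ for every point $Q\in\mathcal U$ that is an $(M+1)$-density point of $\mathcal E$, that is, for every $Q\in\mathcal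 U$ for which there is a $C^1$ chart $(\mathcal W,\Phi)$ of $\mathcal M$ with $Q\in\mathcal W$ and $$\mathcal L^M\big(B_r(\Phi(Q))\setminus \Phi(\mathcal E\cap\mathcal W)\big)=o(r^{M+1})\qquad (r\to 0^+),$$ where $\mathcal L^M$ is the (outer) Lebesgue measure on $\mathbb R^M$ and $B_r(x)$ the open ball of radius $r$ centered at $x$. -/

import Mathlib

open scoped Manifold ContDiff Topology

noncomputable section

namespace MaurerCartan

/-! ### Differential forms -/

/-- A (not necessarily continuous) differential `h`-form on a manifold `M` without boundary,
modelled on `E`: an alternating `h`-linear form on each tangent space. -/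
abbrev DiffForm (E : Type*) [NormedAddCommGroup E] [NormedSpace ℝ E]
    (M : Type*) [TopologicalSpace M] [ChartedSpace E M] (h : ℕ) :=
  ∀ P : M, TangentSpace 𝓘(ℝ, E) P [⋀^Fin h]→L[ℝ] ℝ

namespace DiffForm

variable {E : Type*} [NormedAddCommGroup E] [NormedSpace ℝ E]
  {M : Type*} [TopologicalSpace M] [ChartedSpace E M]
  {E' : Type*} [NormedAddCommGroup E'] [NormedSpace ℝ E']
  {N : Type*} [TopologicalSpace N] [ChartedSpace E' N] {h : ℕ}

/-- The local representation of a form in a chart `Φ`, i.e. `(Φ⁻¹)^* η` as a form on (the open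
subset `Φ.target` of) the model space. -/
def localRep (η : DiffForm E M h) (Φ : OpenPartialHomeomorph M E) (x : E) :
    E [⋀^Fin h]→L[ℝ] ℝ :=
  (η (Φ.symm x)).compContinuousLinearMap (mfderiv 𝓘(ℝ, E) 𝓘(ℝ, E) Φ.symm x)

/-- `η` is of class `C^k` (on a manifold of class at least `C^(k+1)`): all its local
representations are of class `C^k`. -/
def IsOfClass (k : WithTop ℕ∞) (η : DiffForm E M h) : Prop :=
  ∀ Φ ∈ IsManifold.maximalAtlas 𝓘(ℝ, E) (k + 1) M, ContDiffOn ℝ k (η.localRep Φ) Φ.target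

/-- The exterior derivative, computed at `P` in the preferred chart `Φ` at `P`:
`(dη)_P = (Φ^* d((Φ⁻¹)^* η))_P`. -/
def d (η : DiffForm E M h) : DiffForm E M (h + 1) := fun P =>
  (extDeriv (η.localRep (chartAt E P)) (chartAt E P P)).compContinuousLinearMap
    (mfderiv 𝓘(ℝ, E) 𝓘(ℝ, E) (chartAt E P) P)

/-- The pullback `f^* η`, `(f^* η)_P (v₁, …) = η_{f(P)} (df_P v₁, …)`. -/
def pullback (f : M → N) (η : DiffForm E' N h) : DiffForm E M h := fun P =>
  (η (f P)).compContinuousLinearMap (mfderiv 𝓘(ℝ, E) 𝓘(ℝ, E') f P)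

/-- The differential of a real function, as a `1`-form. -/
def ofFun (g : M → ℝ) : DiffForm E M 1 := fun P =>
  ContinuousAlternatingMap.ofSubsingleton ℝ (TangentSpace 𝓘(ℝ, E) P) ℝ (0 : Fin 1)
    (mfderiv 𝓘(ℝ, E) 𝓘(ℝ, ℝ) g P)

/-- The exterior product of two `1`-forms, `(α ∧ β)(v, w) = α(v) β(w) - α(w) β(v)`. -/
def wedge (α β : DiffForm E M 1) : DiffForm E M 2 := fun P =>
  { toFun := fun v =>
      α P (fun _ => v 0) * β P (fun _ => v 1) - α P (fun _ => v 1) * β P (fun _ => v 0)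
    map_update_add' := by
      intro _ v i x y
      have add1 : ∀ (θ : TangentSpace 𝓘(ℝ, E) P [⋀^Fin 1]→L[ℝ] ℝ) x y,
          θ (fun _ => x + y) = θ (fun _ => x) + θ (fun _ => y) := fun θ x y =>
        map_add ((ContinuousAlternatingMap.ofSubsingleton ℝ
          (TangentSpace 𝓘(ℝ, E) P) ℝ (0 : Fin 1)).symm θ) x y
      fin_cases i <;> simp [Function.update, add1] <;> ring
    map_update_smul' := by
      intro _ v i c x
      have smul1 : ∀ (θ : TangentSpace 𝓘(ℝ, E) P [⋀^Fin 1]→L[ℝ] ℝ) (c : ℝ) x,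
          θ (fun _ => c • x) = c * θ (fun _ => x) := fun θ c x =>
        map_smul ((ContinuousAlternatingMap.ofSubsingleton ℝ
          (TangentSpace 𝓘(ℝ, E) P) ℝ (0 : Fin 1)).symm θ) c x
      fin_cases i <;> simp [Function.update, smul1] <;> ring
    map_eq_zero_of_eq' := by
      intro v i j hv hij
      have h01 : v 0 = v 1 := by
        fin_cases i <;> fin_cases j <;> simp_all
      simp [h01]
    cont := by
      have c1 : ∀ (θ : TangentSpace 𝓘(ℝ, E) P [⋀^Fin 1]→L[ℝ] ℝ) (i : Fin 2),
          Continuous (fun v : Fin 2 → TangentSpace 𝓘(ℝ, E) P => θ (fun _ => v i)) :=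
        fun θ i => θ.cont.comp (continuous_pi fun _ => continuous_apply i)
      exact ((c1 _ 0).mul (c1 _ 1)).sub ((c1 _ 1).mul (c1 _ 0)) }

end DiffForm

/-! ### Matrix-valued differential forms -/

/-- An `L × L` matrix of differential `h`-forms. -/
abbrev MatForm (L : ℕ) (E : Type*) [NormedAddCommGroup E] [NormedSpace ℝ E]
    (M : Type*) [TopologicalSpace M] [ChartedSpace E M] (h : ℕ) :=
  Matrix (Fin L) (Fin L) (DiffForm E M h)

namespace MatForm

variable {L : ℕ} {E : Type*} [NormedAddCommGroup E] [NormedSpace ℝ E]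
  {M : Type*} [TopologicalSpace M] [ChartedSpace E M]
  {E' : Type*} [NormedAddCommGroup E'] [NormedSpace ℝ E']
  {N : Type*} [TopologicalSpace N] [ChartedSpace E' N] {h : ℕ}

/-- The value `η_P = (η^{(ij)}_P)` of a matrix-valued form at `P`. -/
def valueAt (η : MatForm L E M h) (P : M) :
    Matrix (Fin L) (Fin L) (TangentSpace 𝓘(ℝ, E) P [⋀^Fin h]→L[ℝ] ℝ) :=
  Matrix.of fun i j => η i j P

/-- All entries are of class `C^k`. -/
def IsOfClass (k : WithTop ℕ∞) (η : MatForm L E M h) : Prop :=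
  ∀ i j, (η i j).IsOfClass k

/-- The entrywise exterior derivative. -/
def d (η : MatForm L E M h) : MatForm L E M (h + 1) := Matrix.of fun i j => (η i j).d

/-- The entrywise pullback. -/
def pullback (f : M → N) (η : MatForm L E' N h) : MatForm L E M h :=
  Matrix.of fun i j => (η i j).pullback f

/-- The exterior product of matrix-valued `1`-forms,
`(α ∧ β)^{(ij)} = ∑ q, α^{(iq)} ∧ β^{(qj)}`. -/
def wedge (α β : MatForm L E M 1) : MatForm L E M 2 :=
  Matrix.of fun i j => ∑ q, (α i q).wedge (β q j)

end MatForm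

/-! ### The Maurer-Cartan form -/

/-- The coordinates `(z_{ij})` identify `GL(L, ℝ)` with an open subset of `ℝ^{L × L}`. -/
theorem isOpenEmbedding_glCoord (L : ℕ) :
    Topology.IsOpenEmbedding
      (fun (z : Matrix.GeneralLinearGroup (Fin L) ℝ) (i j : Fin L) => z i j) := by
  let _ : NormedRing (Matrix (Fin L) (Fin L) ℝ) := Matrix.linftyOpNormedRing
  have _ : @CompleteSpace (Matrix (Fin L) (Fin L) ℝ) PseudoMetricSpace.toUniformSpace :=
    inferInstanceAs (CompleteSpace (Fin L → Fin L → ℝ))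
  exact Units.isOpenEmbedding_val (R := Matrix (Fin L) (Fin L) ℝ)

/-- The standard manifold structure of `GL(L, ℝ)`, with the single global chart `(z_{ij})`. -/
instance instChartedSpaceGL (L : ℕ) :
    ChartedSpace (Fin L → Fin L → ℝ) (Matrix.GeneralLinearGroup (Fin L) ℝ) :=
  (isOpenEmbedding_glCoord L).singletonChartedSpace

/-- The form `γ_z = z⁻¹ dz` on `GL(L, ℝ)`, i.e. `γ^{(ij)}_z = ∑ q, (z⁻¹)_{iq} dz_{qj}`, where
`z_{qj}` are the coordinate functions on `GL(L, ℝ)`. -/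
def glForm (L : ℕ) :
    MatForm L (Fin L → Fin L → ℝ) (Matrix.GeneralLinearGroup (Fin L) ℝ) 1 :=
  Matrix.of fun i j z => ∑ q, ((z⁻¹ : Matrix.GeneralLinearGroup (Fin L) ℝ) i q) •
    DiffForm.ofFun (E := Fin L → Fin L → ℝ)
      (fun y : Matrix.GeneralLinearGroup (Fin L) ℝ => y q j) z

section LieSubgroup

variable {L : ℕ} (n : ℕ) {G : Type*} [TopologicalSpace G]
  [ChartedSpace (EuclideanSpace ℝ (Fin n)) G] [Group G]

/-- The Lie group `G`, of dimension `n`, is a Lie subgroup of `GL(L, ℝ)` with inclusion `ι`: the map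
`ι` is an injective smooth homomorphism that is an immersion.  (Embedded, equivalently closed,
subgroups are the case in which `ι` is moreover a homeomorphism onto its image.) -/
structure IsLieSubgroupInclusion [LieGroup (𝓡 n) ∞ G]
    (ι : G →* Matrix.GeneralLinearGroup (Fin L) ℝ) : Prop where
  injective : Function.Injective ι
  contMDiff : ContMDiff (𝓡 n) 𝓘(ℝ, Fin L → Fin L → ℝ) ∞ ι
  immersion : ∀ g : G,
    Function.Injective (mfderiv (𝓡 n) 𝓘(ℝ, Fin L → Fin L → ℝ) ι g)

/-- The Maurer-Cartan form `Γ_G = ι^* γ` of a Lie subgroup of `GL(L, ℝ)` with inclusion `ι`. -/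
def maurerCartanForm (ι : G →* Matrix.GeneralLinearGroup (Fin L) ℝ) :
    MatForm L (EuclideanSpace ℝ (Fin n)) G 1 :=
  (glForm L).pullback ι

end LieSubgroup

/-! ### Superdensity -/

/-- `P` is an `s`-density point of the subset `A` of the `m`-dimensional manifold `M`: in some `C^1`
chart `Φ` around `P`, the (outer) Lebesgue measure of `B_r(Φ(P)) \ Φ(A ∩ W)`, where `W` is the
domain of `Φ`, is `o(r^s)` as `r → 0+`. -/
def IsDensityPoint (m : ℕ) {M : Type*} [TopologicalSpace M]
    [ChartedSpace (EuclideanSpace ℝ (Fin m)) M] (s : ℝ) (A : Set M) (P : M) : Prop :=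
  ∃ Φ ∈ IsManifold.maximalAtlas (𝓡 m) 1 M, P ∈ Φ.source ∧
    (fun r : ℝ => MeasureTheory.volume.real (Metric.ball (Φ P) r \ Φ '' (A ∩ Φ.source)))
      =o[𝓝[>] (0 : ℝ)] fun r : ℝ => r ^ s

end MaurerCartan

end

/-! In a chart put `z = ι ∘ f` and let `ψ` be the matrix of local representatives of `φ`. On the
coincidence set `ψ = z⁻¹ dz`, that is `dz = zψ`. If `z` were `C²` and this held on an open set,
differentiating would give `0 = dz ∧ ψ + z dψ = z (ψ ∧ ψ + dψ)`. Here `z` is only `C¹` and the set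
may have empty interior, so the vanishing of `d(zψ)` at the density point needs another argument.

It comes from a weak form of `d(dg) = 0`. For `α` of class `C¹` and `g` of class `C¹`, testing `dα`
against a bump of radius `r` at `x` and integrating by parts leaves `α - dg` paired with the
gradient of the bump. This integrand lives on the part of `B_r(x)` where `α ≠ dg`. After rescaling
to the unit ball its integral is at most a constant times `r⁻¹ · r⁻ᴹ · o(r^(M+1))`, which tends to
`0`, while the tested side tends to a positive multiple of `dα` at `x`
(`fderiv_symm_of_superdense_of_contDiff`).

Apply this to each entry of `α = zψ`. A superdensity point lies in the closure of the set, so `dz =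
zψ` also holds at the point itself by continuity. The product rule and multiplication by `z⁻¹`
conclude (`structure_equation_of_superdense`). Superdensity survives `C¹` changes of chart
(`superdense_image`), so the preferred chart used by `d` can replace the chart supplied by the
hypothesis. -/

namespace MaurerCartan

open MeasureTheory Filter Asymptotics Metric Module

/-! ### Closedness at superdensity points: globally defined data -/

section Superdensity

variable {E : Type*} [NormedAddCommGroup E] [NormedSpace ℝ E] [FiniteDimensional ℝ E]
  [MeasurableSpace E] [BorelSpace E] (μ : Measure E) [μ.IsAddHaarMeasure]

/-- Integration by parts against a test function: the exterior derivative of `α` only sees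
the difference of `α` and an exact form. -/
theorem integral_mul_antisymm_fderiv {η : E → ℝ} (hη : ContDiff ℝ 2 η) (hc : HasCompactSupport η)
    {g : E → ℝ} (hg : ContDiff ℝ 1 g) {α : E → E →L[ℝ] ℝ} (hα : ContDiff ℝ 1 α) (v w : E) :
    ∫ y, η y * (fderiv ℝ α y v w - fderiv ℝ α y w v) ∂μ =
      ∫ y, (fderiv ℝ η y w * (α y v - fderiv ℝ g y v)
        - fderiv ℝ η y v * (α y w - fderiv ℝ g y w)) ∂μ := by
  have hη1 : ContDiff ℝ 1 η := hη.of_le (by norm_num)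
  have hdη : ∀ u, ContDiff ℝ 1 (fun y => fderiv ℝ η y u) := fun u =>
    (hη.fderiv_right (m := 1) (by norm_num)).clm_apply contDiff_const
  have hdc : ∀ u, HasCompactSupport (fun y => fderiv ℝ η y u) := fun u =>
    hc.fderiv_apply (𝕜 := ℝ) u
  have hαu : ∀ u, ContDiff ℝ 1 (fun y => α y u) := fun u => hα.clm_apply contDiff_const
  have cfd : ∀ {h : E → ℝ}, ContDiff ℝ 1 h → ∀ u, Continuous (fun y => fderiv ℝ h y u) :=
    fun hh u => (hh.continuous_fderiv (by norm_num)).clm_apply continuous_const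
  have int : ∀ {a b : E → ℝ}, Continuous a → Continuous b → HasCompactSupport a →
      Integrable (fun y => a y * b y) μ := fun ha hb hac =>
    (ha.mul hb).integrable_of_hasCompactSupport hac.mul_right
  have ibp : ∀ {a b : E → ℝ}, ContDiff ℝ 1 a → ContDiff ℝ 1 b → HasCompactSupport a → ∀ u,
      ∫ y, a y * fderiv ℝ b y u ∂μ = - ∫ y, fderiv ℝ a y u * b y ∂μ := by
    intro a b ha hb hac u
    exact integral_mul_fderiv_eq_neg_fderiv_mul_of_integrable
      (int (cfd ha u) hb.continuous (hac.fderiv_apply (𝕜 := ℝ) u))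
      (int ha.continuous (cfd hb u) hac) (int ha.continuous hb.continuous hac)
      (fun x _ => ha.differentiable (by norm_num) x) (fun x _ => hb.differentiable (by norm_num) x)
  have hfd : ∀ y a b, fderiv ℝ α y a b = fderiv ℝ (fun y => α y b) y a := by
    intro y a b
    have hd := hα.differentiable (by norm_num) y
    rw [fderiv_clm_apply hd (differentiableAt_const b)]
    simp
  -- The weak form of `d(dg) = 0`. As `g` is only `C¹`, both derivatives are moved onto the `C²`
  -- function `η`, whose second derivative is symmetric.
  have symm : ∫ y, fderiv ℝ η y w * fderiv ℝ g y v ∂μ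
      = ∫ y, fderiv ℝ η y v * fderiv ℝ g y w ∂μ := by
    rw [ibp (hdη w) hg (hdc w) v, ibp (hdη v) hg (hdc v) w]
    congr 2
    ext y
    congr 1
    have hs : IsSymmSndFDerivAt ℝ η y := hη.contDiffAt.isSymmSndFDerivAt (by simp)
    have hd := (hη.fderiv_right (m := 1) (by norm_num)).differentiable (by norm_num) y
    rw [fderiv_clm_apply hd (differentiableAt_const w),
      fderiv_clm_apply hd (differentiableAt_const v)]
    simpa using hs v w
  simp only [hfd, mul_sub]
  rw [integral_sub (int hη.continuous (cfd (hαu w) v) hc) (int hη.continuous (cfd (hαu v) w) hc),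
    ibp hη1 (hαu w) hc v, ibp hη1 (hαu v) hc w, integral_sub, integral_sub, integral_sub, symm]
  · ring
  · exact int (hdη v).continuous (hαu w).continuous (hdc v)
  · exact int (hdη v).continuous (cfd hg w) (hdc v)
  · exact int (hdη w).continuous (hαu v).continuous (hdc w)
  · exact int (hdη w).continuous (cfd hg v) (hdc w)
  · exact (int (hdη w).continuous (hαu v).continuous (hdc w)).sub
      (int (hdη w).continuous (cfd hg v) (hdc w))
  · exact (int (hdη v).continuous (hαu w).continuous (hdc v)).sub
      (int (hdη v).continuous (cfd hg w) (hdc v))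

theorem measureReal_preimage_add_smul (x : E) {r : ℝ} (hr : 0 < r) (s : Set E) :
    μ.real ((fun y => x + r • y) ⁻¹' s) = (r ^ finrank ℝ E)⁻¹ * μ.real s := by
  have h : (fun y => x + r • y) ⁻¹' s = (r • ·) ⁻¹' ((x + ·) ⁻¹' s) := rfl
  rw [Measure.real, h, Measure.addHaar_preimage_smul μ hr.ne', measure_preimage_add,
    ENNReal.toReal_mul, ENNReal.toReal_ofReal (abs_nonneg _), abs_of_pos (by positivity)]
  rfl

/-- If a `C¹` form `α` agrees with the exact form `dg` on a set that is superdense at `x`,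
then `α` is closed at `x`. -/
theorem fderiv_symm_of_superdense_of_contDiff {g : E → ℝ} (hg : ContDiff ℝ 1 g)
    {α : E → E →L[ℝ] ℝ} (hα : ContDiff ℝ 1 α) (x : E)
    (h : (fun r : ℝ => μ.real (ball x r \ {y | fderiv ℝ g y = α y}))
      =o[𝓝[>] (0 : ℝ)] fun r : ℝ => r ^ (finrank ℝ E + 1)) (v w : E) :
    fderiv ℝ α x v w = fderiv ℝ α x w v := by
  let η : ContDiffBump (0 : E) := ⟨1 / 2, 1, by norm_num, by norm_num⟩
  have hη : ContDiff ℝ 2 η := η.contDiff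
  have hc : HasCompactSupport η := η.hasCompactSupport
  have hdη : ∀ u, Continuous (fun y => fderiv ℝ η y u) := fun u =>
    (hη.continuous_fderiv (by norm_num)).clm_apply continuous_const
  set D : E → ℝ := fun y => fderiv ℝ α y v w - fderiv ℝ α y w v with hD
  have hDc : Continuous D := by
    have := hα.continuous_fderiv (by norm_num)
    fun_prop
  set θ : E → E →L[ℝ] ℝ := fun y => α y - fderiv ℝ g y with hθ
  have hθc : Continuous θ := hα.continuous.sub (hg.continuous_fderiv (by norm_num))
  set F : ℝ → E → ℝ := fun r y =>
    fderiv ℝ η y w * θ (x + r • y) v - fderiv ℝ η y v * θ (x + r • y) w with hF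
  have hFc : Continuous F.uncurry := by
    have h1 : Continuous (fun p : ℝ × E => fderiv ℝ η p.2 w) := (hdη w).comp continuous_snd
    have h2 : Continuous (fun p : ℝ × E => fderiv ℝ η p.2 v) := (hdη v).comp continuous_snd
    have h3 : Continuous (fun p : ℝ × E => θ (x + p.1 • p.2)) := hθc.comp (by fun_prop)
    exact (h1.mul (h3.clm_apply continuous_const)).sub (h2.mul (h3.clm_apply continuous_const))
  -- Integration by parts for the pullbacks of `g` and `α` under `y ↦ x + r • y`. The derivative of
  -- the pulled back `α` carries `r²`, the difference `α - dg` only `r`; the quotient is the factor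
  -- `r⁻¹`.
  have key : ∀ r : ℝ, 0 < r → ∫ y, η y * D (x + r • y) ∂μ = r⁻¹ * ∫ y, F r y ∂μ := by
    intro r hr
    have haff : ∀ y : E, HasFDerivAt (fun y : E => x + r • y)
        (r • ContinuousLinearMap.id ℝ E) y := fun y =>
      ((hasFDerivAt_id y).const_smul r).const_add x
    have hsm : ContDiff ℝ 1 (fun y : E => x + r • y) := by fun_prop
    have e := integral_mul_antisymm_fderiv μ hη hc (hg.comp hsm)
      (α := fun y => r • (α ∘ fun y : E => x + r • y) y)
      ((hα.comp hsm).const_smul r) v w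
    have e1 : ∀ y, fderiv ℝ (g ∘ fun y : E => x + r • y) y = r • fderiv ℝ g (x + r • y) := by
      intro y
      have := ((hg.differentiable (by norm_num) (x + r • y)).hasFDerivAt.comp y (haff y)).fderiv
      rw [this]
      ext u
      simp
    have e2 : ∀ y a, fderiv ℝ (fun y => r • (α ∘ fun y : E => x + r • y) y) y a
        = (r * r) • fderiv ℝ α (x + r • y) a := by
      intro y a
      have := (((hα.differentiable (by norm_num)
        (x + r • y)).hasFDerivAt.comp y (haff y)).const_smul r).fderiv
      rw [show (fun y => r • (α ∘ fun y : E => x + r • y) y)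
        = r • (α ∘ fun y : E => x + r • y) from rfl, this]
      simp [mul_smul]
    simp only [e1, e2] at e
    have l : ∫ y, η y * (((r * r) • fderiv ℝ α (x + r • y) v) w
        - ((r * r) • fderiv ℝ α (x + r • y) w) v) ∂μ = (r * r) * ∫ y, η y * D (x + r • y) ∂μ := by
      rw [← integral_const_mul]
      congr 1
      ext y
      simp [hD]
      ring
    have l' : ∀ y, fderiv ℝ η y w * ((r • (α ∘ fun y : E => x + r • y) y) v
          - (r • fderiv ℝ g (x + r • y)) v)
        - fderiv ℝ η y v * ((r • (α ∘ fun y : E => x + r • y) y) w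
          - (r • fderiv ℝ g (x + r • y)) w) = r * F r y := by
      intro y
      simp [hF, hθ]
      ring
    rw [l] at e
    simp only [l'] at e
    rw [integral_const_mul] at e
    field_simp
    have : r * (r * ∫ y, η y * D (x + r • y) ∂μ - ∫ y, F r y ∂μ) = 0 := by linear_combination e
    rcases mul_eq_zero.1 this with h | h
    · exact absurd h hr.ne'
    · linarith
  obtain ⟨C, hC⟩ : ∃ C, ∀ r ∈ Set.Icc (0 : ℝ) 1, ∀ y ∈ closedBall (0 : E) 1, ‖F r y‖ ≤ C := by
    obtain ⟨C, hC⟩ := (isCompact_Icc.prod (isCompact_closedBall (0 : E) 1)).exists_bound_of_continuousOn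
      (s := Set.Icc (0 : ℝ) 1 ×ˢ closedBall (0 : E) 1) hFc.continuousOn
    exact ⟨C, fun r hr y hy => hC (r, y) ⟨hr, hy⟩⟩
  -- A zero of the nonnegative `η` is a minimum, which covers the unit sphere as well as its
  -- exterior.
  have supp : ∀ y u, y ∉ ball (0 : E) 1 → fderiv ℝ η y u = 0 := by
    intro y u hy
    have hη0 : η y = 0 := by
      by_contra hne
      have : y ∈ Function.support η := hne
      rw [η.support_eq] at this
      exact hy this
    have : IsLocalMin η y := Eventually.of_forall fun z => by rw [hη0]; exact η.nonneg
    rw [this.fderiv_eq_zero]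
    simp
  set S := {y | fderiv ℝ g y = α y} with hS
  -- `F r` vanishes off the rescaled bad set `A`, whose measure gains `r ^ (-finrank)`. Together
  -- with `r⁻¹` this is exactly the exponent `finrank ℝ E + 1`.
  have bound : ∀ r ∈ Set.Ioc (0 : ℝ) 1,
      ‖r⁻¹ * ∫ y, F r y ∂μ‖ ≤ C * ((r ^ (finrank ℝ E + 1))⁻¹ * μ.real (ball x r \ S)) := by
    intro r hr
    set A := (fun y => x + r • y) ⁻¹' (ball x r \ S) with hA
    have hAsub : A ⊆ ball (0 : E) 1 := by
      intro y hy
      have := hy.1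
      rw [mem_ball, dist_eq_norm, add_sub_cancel_left, norm_smul, Real.norm_of_nonneg hr.1.le] at this
      rw [mem_ball_zero_iff]
      by_contra hcon
      nlinarith [hr.1]
    have hF0 : ∀ y, y ∉ A → F r y = 0 := by
      intro y hy
      by_cases hb : y ∈ ball (0 : E) 1
      · have hyS : x + r • y ∈ S := by
          by_contra hns
          refine hy ⟨?_, hns⟩
          rw [mem_ball, dist_eq_norm, add_sub_cancel_left, norm_smul, Real.norm_of_nonneg hr.1.le]
          rw [mem_ball_zero_iff] at hb
          nlinarith [hr.1]
        have : θ (x + r • y) = 0 := by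
          rw [hθ]; exact sub_eq_zero.2 hyS.symm
        simp [hF, this]
      · simp [hF, supp y _ hb]
    have hmA : μ A < ⊤ := (measure_mono hAsub).trans_lt measure_ball_lt_top
    rw [← setIntegral_eq_integral_of_forall_compl_eq_zero hF0]
    have h1 := norm_setIntegral_le_of_norm_le_const (f := F r) (C := C) hmA
      (fun y hy => hC r ⟨hr.1.le, hr.2⟩ y (ball_subset_closedBall (hAsub hy)))
    rw [hA, measureReal_preimage_add_smul μ x hr.1, ← hA] at h1
    rw [norm_mul, norm_inv, Real.norm_of_nonneg hr.1.le, pow_succ, mul_inv]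
    calc r⁻¹ * ‖∫ y in A, F r y ∂μ‖ ≤ r⁻¹ * _ :=
          mul_le_mul_of_nonneg_left h1 (inv_nonneg.2 hr.1.le)
      _ = _ := by ring
  have lim0 : Tendsto (fun r : ℝ => r⁻¹ * ∫ y, F r y ∂μ) (𝓝[>] 0) (𝓝 0) := by
    have t : Tendsto (fun r : ℝ => C * ((r ^ (finrank ℝ E + 1))⁻¹ * μ.real (ball x r \ S)))
        (𝓝[>] 0) (𝓝 0) := by
      have := (h.tendsto_div_nhds_zero).const_mul C
      rw [mul_zero] at this
      refine this.congr fun r => ?_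
      rw [div_eq_inv_mul]
    refine squeeze_zero_norm' ?_ t
    filter_upwards [Ioc_mem_nhdsGT (zero_lt_one' ℝ)] with r hr using bound r hr
  -- By continuity of `D` the limit is `D x` times the positive integral of `η`, so a zero limit
  -- forces `D x = 0`.
  have lim1 : Tendsto (fun r : ℝ => ∫ y, η y * D (x + r • y) ∂μ) (𝓝[>] 0)
      (𝓝 (∫ y, η y * D x ∂μ)) := by
    have hcont : Continuous (fun p : ℝ × E => η p.2 * D (x + p.1 • p.2)) :=
      (hη.continuous.comp continuous_snd).mul (hDc.comp (by fun_prop))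
    have := continuous_parametric_integral_of_continuous (μ := μ)
      (f := fun (r : ℝ) y => η y * D (x + r • y)) hcont hc.isCompact
    have hset : ∀ r : ℝ, ∫ y in tsupport η, η y * D (x + r • y) ∂μ
        = ∫ y, η y * D (x + r • y) ∂μ := fun r =>
      setIntegral_eq_integral_of_forall_compl_eq_zero fun y hy => by
        rw [image_eq_zero_of_notMem_tsupport hy, zero_mul]
    simp only [hset] at this
    have t := (this.tendsto 0).mono_left (nhdsWithin_le_nhds (s := Set.Ioi 0))
    simpa using t
  have lim2 := lim0.congr' (f₂ := fun r : ℝ => ∫ y, η y * D (x + r • y) ∂μ) (by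
    filter_upwards [self_mem_nhdsWithin] with r hr using (key r hr).symm)
  have e := tendsto_nhds_unique lim1 lim2
  rw [integral_mul_const] at e
  rcases mul_eq_zero.1 e with h | h
  · exact absurd h (η.integral_pos (μ := μ)).ne'
  · exact sub_eq_zero.1 h

end Superdensity

/-! ### Localization, change of variables and the structure equation in a vector space -/

section LocalSuperdensity

variable {E : Type*} [NormedAddCommGroup E] [NormedSpace ℝ E] [FiniteDimensional ℝ E]

/-- A function of class `C^k` near `x` coincides near `x` with one of class `C^k` everywhere. -/
theorem exists_contDiff_eventuallyEq {F : Type*} [NormedAddCommGroup F] [NormedSpace ℝ F]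
    {k : ℕ∞} {f : E → F} {V : Set E} (hV : IsOpen V) (hf : ContDiffOn ℝ k f V) {x : E}
    (hx : x ∈ V) : ∃ f' : E → F, ContDiff ℝ k f' ∧ f' =ᶠ[𝓝 x] f := by
  obtain ⟨ε, hε, hεV⟩ := nhds_basis_closedBall.mem_iff.1 (hV.mem_nhds hx)
  -- The outer radius `ε` makes the closed support of `χ` the closed ball contained in `V`.
  let χ : ContDiffBump x := ⟨ε / 2, ε, by positivity, by linarith⟩
  refine ⟨fun y => χ y • f y, contDiff_iff_contDiffAt.2 fun y => ?_, ?_⟩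
  · by_cases hy : y ∈ V
    · exact χ.contDiff.contDiffAt.smul (hf.contDiffAt (hV.mem_nhds hy))
    · have : y ∉ tsupport χ := fun h => hy (hεV (by rwa [χ.tsupport_eq] at h))
      have h0 : (fun y => χ y • f y) =ᶠ[𝓝 y] fun _ => 0 := by
        filter_upwards [notMem_tsupport_iff_eventuallyEq.1 this] with z hz
        simp [hz]
      exact contDiffAt_const.congr_of_eventuallyEq h0
  · filter_upwards [χ.eventuallyEq_one] with y hy
    simp [hy]

variable [MeasurableSpace E] [BorelSpace E] (μ : Measure E) [μ.IsAddHaarMeasure]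

/-- Otherwise, for small `r`, the missing part is the whole ball, of measure a positive constant
times `r ^ finrank ℝ E`, which is not even `o(r ^ finrank ℝ E)`. -/
theorem mem_closure_of_superdense {S : Set E} {x : E}
    (h : (fun r : ℝ => μ.real (ball x r \ S)) =o[𝓝[>] (0 : ℝ)]
      fun r : ℝ => r ^ (finrank ℝ E + 1)) : x ∈ closure S := by
  by_contra hx
  obtain ⟨ε, hε, hεS⟩ := Metric.isOpen_iff.1 isClosed_closure.isOpen_compl x hx
  have t : Tendsto (fun r : ℝ => r * (μ.real (ball x r \ S) / r ^ (finrank ℝ E + 1)))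
      (𝓝[>] 0) (𝓝 (0 * 0)) :=
    (tendsto_id.mono_left nhdsWithin_le_nhds).mul h.tendsto_div_nhds_zero
  have t' : Tendsto (fun r : ℝ => r * (μ.real (ball x r \ S) / r ^ (finrank ℝ E + 1)))
      (𝓝[>] 0) (𝓝 (μ.real (ball (0 : E) 1))) := by
    refine tendsto_const_nhds.congr' ?_
    filter_upwards [Ioc_mem_nhdsGT hε] with r hr
    have : ball x r \ S = ball x r := by
      rw [sdiff_eq_left, Set.disjoint_left]
      exact fun y hy hyS => hεS (ball_subset_ball hr.2 hy) (subset_closure hyS)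
    have hr0 := hr.1.ne'
    rw [this, measureReal_def, measureReal_def, Measure.addHaar_ball_of_pos μ x hr.1, ENNReal.toReal_mul,
      ENNReal.toReal_ofReal (by have := hr.1; positivity), pow_succ]
    field_simp
  have e := tendsto_nhds_unique t t'
  rw [mul_zero] at e
  exact (ENNReal.toReal_pos (measure_ball_pos μ (0 : E) one_pos).ne' measure_ball_lt_top.ne).ne e

-- Superdensity depends only on the germ of the set at `x`; this allows intersecting with a
-- neighbourhood or replacing functions by extensions of their germs.
omit [BorelSpace E] in
theorem superdense_mono {S S' : Set E} {x : E} (hSS : ∀ᶠ y in 𝓝 x, y ∈ S → y ∈ S')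
    (h : (fun r : ℝ => μ.real (ball x r \ S)) =o[𝓝[>] (0 : ℝ)]
      fun r : ℝ => r ^ (finrank ℝ E + 1)) :
    (fun r : ℝ => μ.real (ball x r \ S')) =o[𝓝[>] (0 : ℝ)]
      fun r : ℝ => r ^ (finrank ℝ E + 1) := by
  obtain ⟨ε, hε, hεS⟩ := Metric.eventually_nhds_iff_ball.1 hSS
  refine IsBigO.trans_isLittleO (IsBigO.of_bound 1 ?_) h
  filter_upwards [Ioc_mem_nhdsGT hε] with r hr
  rw [one_mul, Real.norm_of_nonneg measureReal_nonneg, Real.norm_of_nonneg measureReal_nonneg]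
  exact measureReal_mono (fun y hy => ⟨hy.1, fun hyS => hy.2 (hεS y (ball_subset_ball hr.2 hy.1) hyS)⟩)
    (measure_ne_top_of_subset Set.sdiff_subset measure_ball_lt_top.ne)

/-- If a `C¹` form `α` agrees with the exact form `dg` on a set that is superdense at `x`,
then `α` is closed at `x`. -/
theorem fderiv_symm_of_superdense {V : Set E} (hV : IsOpen V) {x : E} (hx : x ∈ V)
    {g : E → ℝ} (hg : ContDiffOn ℝ 1 g V)
    {α : E → E →L[ℝ] ℝ} (hα : ContDiffOn ℝ 1 α V) {S : Set E} (hS : ∀ y ∈ S, fderiv ℝ g y = α y)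
    (h : (fun r : ℝ => μ.real (ball x r \ S)) =o[𝓝[>] (0 : ℝ)]
      fun r : ℝ => r ^ (finrank ℝ E + 1)) (v w : E) :
    fderiv ℝ α x v w = fderiv ℝ α x w v := by
  obtain ⟨g', hg', hgg⟩ := exists_contDiff_eventuallyEq (k := 1) hV hg hx
  obtain ⟨α', hα', hαα⟩ := exists_contDiff_eventuallyEq (k := 1) hV hα hx
  rw [← hαα.fderiv_eq]
  refine fderiv_symm_of_superdense_of_contDiff μ hg' hα' x (superdense_mono μ ?_ h) v w
  -- Equality of derivatives at `y` needs `g' = g` near `y`, not just at `y`.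
  filter_upwards [hαα, hgg.eventuallyEq_nhds] with y h1 h2 hy
  show fderiv ℝ g' y = α' y
  rw [h2.fderiv_eq, h1, hS y hy]

/-- Superdensity points are preserved by local `C¹` diffeomorphisms. -/
theorem superdense_image (T : OpenPartialHomeomorph E E) {x : E} (hx : x ∈ T.source)
    (hT : ContDiffAt ℝ 1 T x) (hT' : ContDiffAt ℝ 1 T.symm (T x)) {S : Set E}
    (h : (fun r : ℝ => μ.real (ball x r \ S)) =o[𝓝[>] (0 : ℝ)]
      fun r : ℝ => r ^ (finrank ℝ E + 1)) :
    (fun r : ℝ => μ.real (ball (T x) r \ T '' (S ∩ T.source))) =o[𝓝[>] (0 : ℝ)]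
      fun r : ℝ => r ^ (finrank ℝ E + 1) := by
  obtain ⟨K, t, ht, hK⟩ := hT.exists_lipschitzOnWith
  obtain ⟨K', t', ht', hK'⟩ := hT'.exists_lipschitzOnWith
  -- `μ` is a multiple of Hausdorff measure, so the Lipschitz bound holds for arbitrary, possibly
  -- nonmeasurable, sets.
  have himage : ∀ A ⊆ t, μ (T '' A) ≤ (K : ENNReal) ^ finrank ℝ E * μ A := by
    intro A hA
    rw [Measure.isAddLeftInvariant_eq_smul μ μH[finrank ℝ E]]
    have := (hK.mono hA).hausdorffMeasure_image_le (d := finrank ℝ E) (Nat.cast_nonneg _)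
    rw [ENNReal.rpow_natCast] at this
    simp only [Measure.smul_apply, ENNReal.smul_def, smul_eq_mul]
    calc _ ≤ _ := mul_le_mul_right this _
      _ = _ := by ring
  -- `T.symm` sends `ball (T x) r` into `ball x (c * r)`; the `+ 1` keeps the inequality strict and
  -- `c` positive even if `K' = 0`.
  set c : ℝ := K' + 1 with hc
  have hc0 : 0 < c := by positivity
  have hscale : Tendsto (fun r : ℝ => c * r) (𝓝[>] 0) (𝓝[>] 0) := by
    refine tendsto_nhdsWithin_iff.2 ⟨?_, ?_⟩
    · have : Tendsto (fun r : ℝ => c * r) (𝓝 0) (𝓝 (c * 0)) := tendsto_id.const_mul c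
      rw [mul_zero] at this
      exact this.mono_left nhdsWithin_le_nhds
    · filter_upwards [self_mem_nhdsWithin] with r hr using mul_pos hc0 hr
  have h1 := h.comp_tendsto hscale
  have h2 : ((fun r : ℝ => r ^ (finrank ℝ E + 1)) ∘ fun r => c * r) =O[𝓝[>] (0 : ℝ)]
      fun r : ℝ => r ^ (finrank ℝ E + 1) := by
    simp only [Function.comp_def, mul_pow]
    exact isBigO_const_mul_self _ _ _
  refine IsBigO.trans_isLittleO (IsBigO.of_bound ((K : ℝ) ^ finrank ℝ E) ?_) (h1.trans_isBigO h2)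
  have hsymm : ∀ᶠ y in 𝓝 (T x), y ∈ T.target ∧ y ∈ t' ∧ T.symm y ∈ t :=
    (T.open_target.eventually_mem (T.map_source hx)).and (Eventually.and ht'
      ((T.tendsto_symm hx).eventually ht))
  obtain ⟨ε, hε, hεT⟩ := Metric.eventually_nhds_iff_ball.1 hsymm
  filter_upwards [Ioc_mem_nhdsGT hε] with r hr
  have hsub : ball (T x) r \ T '' (S ∩ T.source) ⊆ T '' ((ball x (c * r) ∩ t) \ S) := by
    rintro y ⟨hy, hyS⟩
    obtain ⟨hy1, hy2, hy3⟩ := hεT y (ball_subset_ball hr.2 hy)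
    refine ⟨T.symm y, ⟨⟨?_, hy3⟩, fun hS => ?_⟩, T.right_inv hy1⟩
    · have := hK'.dist_le_mul y hy2 (T x) (mem_of_mem_nhds ht')
      rw [T.left_inv hx] at this
      rw [mem_ball] at hy ⊢
      calc _ ≤ _ := this
        _ ≤ K' * r := by gcongr
        _ < c * r := by rw [hc]; linarith [hr.1]
    · exact hyS ⟨T.symm y, ⟨hS, T.map_target hy1⟩, T.right_inv hy1⟩
  rw [Real.norm_of_nonneg measureReal_nonneg, Function.comp_apply,
    Real.norm_of_nonneg measureReal_nonneg]
  have hfin : μ (ball x (c * r) \ S) ≠ ⊤ :=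
    measure_ne_top_of_subset Set.sdiff_subset measure_ball_lt_top.ne
  have := calc μ (ball (T x) r \ T '' (S ∩ T.source)) ≤ _ := measure_mono hsub
    _ ≤ _ := himage _ (fun y hy => hy.1.2)
    _ ≤ (K : ENNReal) ^ finrank ℝ E * μ (ball x (c * r) \ S) :=
      mul_le_mul_right (measure_mono (Set.sdiff_subset_sdiff_left Set.inter_subset_left)) _
  have := ENNReal.toReal_mono (ENNReal.mul_ne_top (by simp) hfin) this
  simpa [Measure.real] using this

/-- If a matrix `ψ` of `C¹` forms agrees with `z⁻¹ dz` on a set that is superdense at `x`, then it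
satisfies the structure equation `dψ = - ψ ∧ ψ` at `x`. -/
theorem structure_equation_of_superdense {L : ℕ} {V : Set E} (hV : IsOpen V) {x : E} (hx : x ∈ V)
    {z : E → Matrix.GeneralLinearGroup (Fin L) ℝ}
    (hz : ∀ i j, ContDiffOn ℝ 1 (fun y => z y i j) V)
    {ψ : Fin L → Fin L → E → E →L[ℝ] ℝ} (hψ : ∀ i j, ContDiffOn ℝ 1 (ψ i j) V)
    {S : Set E} (hS : ∀ y ∈ S, ∀ i j,
      ψ i j y = ∑ q, (z y)⁻¹ i q • fderiv ℝ (fun y => z y q j) y)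
    (h : (fun r : ℝ => μ.real (ball x r \ S)) =o[𝓝[>] (0 : ℝ)]
      fun r : ℝ => r ^ (finrank ℝ E + 1)) (v w : E) (i j : Fin L) :
    fderiv ℝ (ψ i j) x v w - fderiv ℝ (ψ i j) x w v =
      -∑ q, (ψ i q x v * ψ q j x w - ψ i q x w * ψ q j x v) := by
  -- Clearing the inverse turns `ψ = z⁻¹ dz` into `dz = zψ`: each entry of `α` is then a `C¹` form
  -- equal on `S` to an exact one.
  set α : Fin L → Fin L → E → E →L[ℝ] ℝ := fun p j y => ∑ i, z y p i • ψ i j y with hα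
  have hαc : ∀ p j, ContDiffOn ℝ 1 (α p j) V := fun p j =>
    ContDiffOn.sum fun i _ => (hz p i).smul (hψ i j)
  have hαS : ∀ y ∈ S, ∀ p j, fderiv ℝ (fun y => z y p j) y = α p j y := by
    intro y hy p j
    simp only [hα, hS y hy, Finset.smul_sum, smul_smul]
    rw [Finset.sum_comm]
    simp only [← Finset.sum_smul]
    have : ∀ q, ∑ i, z y p i * (z y)⁻¹ i q = (1 : Matrix (Fin L) (Fin L) ℝ) p q := by
      intro q
      rw [← Matrix.mul_apply, ← Units.val_mul, mul_inv_cancel, Units.val_one]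
    simp only [this, Matrix.one_apply, ite_smul, one_smul, zero_smul, Finset.sum_ite_eq,
      Finset.mem_univ, if_true]
  -- The point `x` need not lie in `S`, but it lies in its closure, and both sides are continuous on
  -- `V`.
  have hαx : ∀ p j, fderiv ℝ (fun y => z y p j) x = α p j x := by
    intro p j
    have hcl : x ∈ closure (S ∩ V) := by
      refine mem_closure_of_superdense μ (superdense_mono μ ?_ h)
      filter_upwards [hV.mem_nhds hx] with y hy hyS using ⟨hyS, hy⟩
    have c1 : ContinuousWithinAt (fderiv ℝ (fun y => z y p j)) (S ∩ V) x :=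
      ((hz p j).continuousOn_fderiv_of_isOpen hV le_rfl x hx).mono Set.inter_subset_right
    have c2 : ContinuousWithinAt (α p j) (S ∩ V) x :=
      ((hαc p j).continuousOn x hx).mono Set.inter_subset_right
    have := mem_closure_iff_nhdsWithin_neBot.1 hcl
    refine tendsto_nhds_unique c1 (c2.congr' ?_)
    filter_upwards [self_mem_nhdsWithin] with y hy using (hαS y hy.1 p j).symm
  have hdz : ∀ p i, DifferentiableAt ℝ (fun y => z y p i) x := fun p i =>
    ((hz p i).contDiffAt (hV.mem_nhds hx)).differentiableAt (by norm_num)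
  have hdψ : ∀ i j, DifferentiableAt ℝ (ψ i j) x := fun i j =>
    ((hψ i j).contDiffAt (hV.mem_nhds hx)).differentiableAt (by norm_num)
  have hdα : ∀ p j a b, fderiv ℝ (α p j) x a b
      = ∑ i, (α p i x a * ψ i j x b + z x p i * fderiv ℝ (ψ i j) x a b) := by
    intro p j a b
    have : HasFDerivAt (α p j) _ x := HasFDerivAt.fun_sum fun i _ =>
      (hdz p i).hasFDerivAt.smul (hdψ i j).hasFDerivAt
    rw [this.fderiv]
    simp [hαx, add_comm]
  have symm := fun p j => fderiv_symm_of_superdense μ hV hx (hz p j) (hαc p j)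
    (fun y hy => hαS y hy p j) h v w
  set Z : Matrix (Fin L) (Fin L) ℝ := (z x).1 with hZ
  let P : E → Matrix (Fin L) (Fin L) ℝ := fun a => .of fun i j => ψ i j x a
  let D : E → E → Matrix (Fin L) (Fin L) ℝ := fun a b => .of fun i j => fderiv ℝ (ψ i j) x a b
  have eα : ∀ p j a, α p j x a = (Z * P a) p j := by
    intro p j a
    simp [hα, Matrix.mul_apply, P, hZ]
  -- Symmetry of the derivative of `α = zψ`, expanded by the product rule with `dz = zψ` at `x`.
  have e : Z * P v * P w + Z * D v w = Z * P w * P v + Z * D w v := by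
    ext p j
    have := symm p j
    rw [hdα, hdα, Finset.sum_add_distrib, Finset.sum_add_distrib] at this
    simp only [eα] at this
    rw [Matrix.add_apply, Matrix.add_apply, Matrix.mul_apply (M := Z * P v),
      Matrix.mul_apply (M := Z * P w), Matrix.mul_apply (N := D v w), Matrix.mul_apply (N := D w v)]
    exact this
  have e' : D v w - D w v = -(P v * P w - P w * P v) := by
    have hinv : ((z x)⁻¹ : Matrix.GeneralLinearGroup (Fin L) ℝ).1 * Z = 1 := by
      rw [hZ, ← Units.val_mul, inv_mul_cancel, Units.val_one]
    have e2 : Z * (D v w - D w v + (P v * P w - P w * P v)) = 0 := by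
      simp only [mul_add, mul_sub, ← mul_assoc]
      rw [← sub_eq_zero.2 e]
      abel
    have := congrArg (((z x)⁻¹ : Matrix.GeneralLinearGroup (Fin L) ℝ).1 * ·) e2
    simp only [← mul_assoc, hinv, one_mul, mul_zero] at this
    exact eq_neg_of_add_eq_zero_left this
  have := congrFun (congrFun e' i) j
  simpa [Matrix.mul_apply, P, D] using this

end LocalSuperdensity

/-! ### Matrix entries and one-forms read in charts -/

theorem contMDiff_entry {L : ℕ} (i j : Fin L) :
    ContMDiff 𝓘(ℝ, Fin L → Fin L → ℝ) 𝓘(ℝ, ℝ) ∞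
      (fun z : Matrix.GeneralLinearGroup (Fin L) ℝ => z i j) := by
  have h1 : ContMDiff 𝓘(ℝ, Fin L → Fin L → ℝ) 𝓘(ℝ, Fin L → Fin L → ℝ) ∞
      (fun (z : Matrix.GeneralLinearGroup (Fin L) ℝ) (i j : Fin L) => z i j) :=
    contMDiff_isOpenEmbedding (isOpenEmbedding_glCoord L)
  have h2 : ContDiff ℝ ∞ (fun a : Fin L → Fin L → ℝ => a i j) := by fun_prop
  exact h2.contMDiff.comp h1

section Charts

variable {E : Type*} [NormedAddCommGroup E] [NormedSpace ℝ E]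
  {M : Type*} [TopologicalSpace M] [ChartedSpace E M]

/-- The local representation of a `1`-form in a chart, as a field of linear functionals. -/
noncomputable def DiffForm.localFunctional (η : DiffForm E M 1) (Φ : OpenPartialHomeomorph M E) (x : E) :
    E →L[ℝ] ℝ :=
  (ContinuousAlternatingMap.ofSubsingletonLIE (𝕜 := ℝ) (E := E) (F := ℝ) (0 : Fin 1)).symm
    (η.localRep Φ x)

/-- The differentials of the chart and of its inverse cancel; this carries the vector space identity
back to the manifold. -/
theorem DiffForm.localFunctional_mfderiv (η : DiffForm E M 1) {Φ : OpenPartialHomeomorph M E}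
    (hΦ : Φ.MDifferentiable 𝓘(ℝ, E) 𝓘(ℝ, E)) {P : M} (hP : P ∈ Φ.source)
    (v : TangentSpace 𝓘(ℝ, E) P) :
    η.localFunctional Φ (Φ P) (mfderiv 𝓘(ℝ, E) 𝓘(ℝ, E) Φ P v) = η P (fun _ => v) := by
  -- `Φ.symm (Φ P)` and `P` are only propositionally equal; vectors are moved between their tangent
  -- spaces through the common model `E`.
  have base : ∀ {P' : M}, P' = P → ∀ u : E, η P' (fun _ => u) = η P (fun _ => u) := by
    rintro P' rfl u
    rfl
  have e : (mfderiv 𝓘(ℝ, E) 𝓘(ℝ, E) Φ.symm (Φ P)) (mfderiv 𝓘(ℝ, E) 𝓘(ℝ, E) Φ P v) = v :=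
    DFunLike.congr_fun (hΦ.symm_comp_deriv hP) v
  refine Eq.trans ?_ (base (Φ.left_inv hP) v)
  exact congrArg (fun u : E => η (Φ.symm (Φ P)) (fun _ => u)) e

theorem DiffForm.d_apply (η : DiffForm E M 1) (P : M)
    (h : DifferentiableAt ℝ (η.localRep (chartAt E P)) (chartAt E P P))
    (v : Fin 2 → TangentSpace 𝓘(ℝ, E) P) :
    η.d P v =
      fderiv ℝ (η.localFunctional (chartAt E P)) (chartAt E P P)
          (mfderiv 𝓘(ℝ, E) 𝓘(ℝ, E) (chartAt E P) P (v 0))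
          (mfderiv 𝓘(ℝ, E) 𝓘(ℝ, E) (chartAt E P) P (v 1))
        - fderiv ℝ (η.localFunctional (chartAt E P)) (chartAt E P P)
          (mfderiv 𝓘(ℝ, E) 𝓘(ℝ, E) (chartAt E P) P (v 1))
          (mfderiv 𝓘(ℝ, E) 𝓘(ℝ, E) (chartAt E P) P (v 0)) := by
  -- Evaluation on a constant family is a continuous linear isometry, so it commutes with `fderiv`.
  have hf : ∀ a b : E, fderiv ℝ (η.localFunctional (chartAt E P)) (chartAt E P P) a b
      = fderiv ℝ (η.localRep (chartAt E P)) (chartAt E P P) a (fun _ => b) := by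
    intro a b
    have := ((ContinuousAlternatingMap.ofSubsingletonLIE (𝕜 := ℝ) (E := E) (F := ℝ)
      (0 : Fin 1)).symm.toContinuousLinearEquiv.toContinuousLinearMap.hasFDerivAt.comp
        (chartAt E P P) h.hasFDerivAt).fderiv
    exact DFunLike.congr_fun (DFunLike.congr_fun this a) b
  have key : ∀ a : Fin 2 → E, extDeriv (η.localRep (chartAt E P)) (chartAt E P P) a
      = fderiv ℝ (η.localFunctional (chartAt E P)) (chartAt E P P) (a 0) (a 1)
        - fderiv ℝ (η.localFunctional (chartAt E P)) (chartAt E P P) (a 1) (a 0) := by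
    intro a
    have h0 : Fin.removeNth 0 a = fun _ => a 1 := by
      ext k; fin_cases k; rfl
    have h1 : Fin.removeNth 1 a = fun _ => a 0 := by
      ext k; fin_cases k; rfl
    rw [extDeriv, ContinuousAlternatingMap.alternatizeUncurryFin_apply, Fin.sum_univ_two,
      h0, h1, hf, hf]
    simp [sub_eq_add_neg]
  exact key _

end Charts

/-! ### Density points and the Maurer-Cartan form in charts -/

/-- In any `C¹` chart at a density point of a set, the image of the set is superdense. -/
theorem IsDensityPoint.superdense_image_chart {m : ℕ} {M : Type*} [TopologicalSpace M]
    [ChartedSpace (EuclideanSpace ℝ (Fin m)) M] {A : Set M}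
    {P : M} (h : IsDensityPoint m ((m : ℝ) + 1) A P)
    {Ψ : OpenPartialHomeomorph M (EuclideanSpace ℝ (Fin m))}
    (hΨ : Ψ ∈ IsManifold.maximalAtlas (𝓡 m) 1 M) (hP : P ∈ Ψ.source) :
    (fun r : ℝ => volume.real (ball (Ψ P) r \ Ψ '' (A ∩ Ψ.source))) =o[𝓝[>] (0 : ℝ)]
      fun r : ℝ => r ^ (finrank ℝ (EuclideanSpace ℝ (Fin m)) + 1) := by
  obtain ⟨Φ, hΦ, hPΦ, hlim⟩ := h
  have hpow : (fun r : ℝ => r ^ ((m : ℝ) + 1))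
      = fun r : ℝ => r ^ (finrank ℝ (EuclideanSpace ℝ (Fin m)) + 1) := by
    ext r
    rw [finrank_euclideanSpace_fin, ← Real.rpow_natCast]
    push_cast
    rfl
  rw [hpow] at hlim
  have hx : Φ P ∈ (Φ.symm ≫ₕ Ψ).source := by
    simp [hPΦ, hP]
  have hTx : (Φ.symm ≫ₕ Ψ) (Φ P) = Ψ P := by simp [hPΦ]
  have trans : ∀ {Φ Ψ : OpenPartialHomeomorph M (EuclideanSpace ℝ (Fin m))},
      Φ ∈ IsManifold.maximalAtlas (𝓡 m) 1 M → Ψ ∈ IsManifold.maximalAtlas (𝓡 m) 1 M →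
      P ∈ Φ.source → P ∈ Ψ.source → ContDiffAt ℝ 1 (Ψ ∘ Φ.symm) (Φ P) := by
    intro Φ Ψ hΦ hΨ h1 h2
    refine ContMDiffAt.contDiffAt (ContMDiffAt.comp (I' := 𝓡 m) _ ?_
      (contMDiffAt_symm_of_mem_maximalAtlas hΦ (Φ.map_source h1)))
    rw [Φ.left_inv h1]
    exact contMDiffAt_of_mem_maximalAtlas hΨ h2
  have h1 : ContDiffAt ℝ 1 (Φ.symm ≫ₕ Ψ) (Φ P) := by
    simpa using trans hΦ hΨ hPΦ hP
  have h2 : ContDiffAt ℝ 1 (Φ.symm ≫ₕ Ψ).symm (Ψ P) := by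
    simpa using trans hΨ hΦ hP hPΦ
  have := superdense_image volume (Φ.symm ≫ₕ Ψ) hx h1 (by rwa [hTx]) hlim
  rw [hTx] at this
  -- The transition map only sees points in both chart domains, so its image is contained in the set
  -- wanted here.
  refine superdense_mono volume (Eventually.of_forall ?_) this
  rintro _ ⟨_, ⟨⟨p, ⟨hpA, hpΦ⟩, rfl⟩, hs⟩, rfl⟩
  refine ⟨p, ⟨hpA, ?_⟩, ?_⟩
  · simpa [hpΦ] using hs
  · simp [hpΦ]

/-- The pullback of the Maurer-Cartan form under a differentiable map, in terms of the entries of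
the map. -/
theorem pullback_maurerCartanForm_apply {L n : ℕ} {E : Type*} [NormedAddCommGroup E]
    [NormedSpace ℝ E] {M : Type*} [TopologicalSpace M] [ChartedSpace E M]
    {G : Type*} [TopologicalSpace G] [ChartedSpace (EuclideanSpace ℝ (Fin n)) G] [Group G]
    {ι : G →* Matrix.GeneralLinearGroup (Fin L) ℝ}
    (hι : MDifferentiable (𝓡 n) 𝓘(ℝ, Fin L → Fin L → ℝ) ι) {f : M → G} {c : E → M} {y : E}
    (hf : MDifferentiableAt 𝓘(ℝ, E) (𝓡 n) f (c y))
    (hc : MDifferentiableAt 𝓘(ℝ, E) 𝓘(ℝ, E) c y) (i j : Fin L) (v : E) :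
    (((maurerCartanForm n ι).pullback f : MatForm L E M 1) i j (c y))
        (fun _ => mfderiv 𝓘(ℝ, E) 𝓘(ℝ, E) c y v)
      = ∑ q, (ι (f (c y)))⁻¹ i q * fderiv ℝ (fun y => ι (f (c y)) q j) y v := by
  have chain : ∀ q, fderiv ℝ (fun y => ι (f (c y)) q j) y v =
      mfderiv 𝓘(ℝ, Fin L → Fin L → ℝ) 𝓘(ℝ, ℝ)
        (fun z : Matrix.GeneralLinearGroup (Fin L) ℝ => z q j) (ι (f (c y)))
        (mfderiv (𝓡 n) 𝓘(ℝ, Fin L → Fin L → ℝ) ι (f (c y))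
          (mfderiv 𝓘(ℝ, E) (𝓡 n) f (c y) (mfderiv 𝓘(ℝ, E) 𝓘(ℝ, E) c y v))) := by
    intro q
    have h3 : MDifferentiableAt 𝓘(ℝ, Fin L → Fin L → ℝ) 𝓘(ℝ, ℝ)
        (fun z : Matrix.GeneralLinearGroup (Fin L) ℝ => z q j) (ι (f (c y))) :=
      (contMDiff_entry q j).mdifferentiable (by simp) _
    have e := mfderiv_comp y h3 ((hι (f (c y))).comp y (hf.comp y hc))
    rw [mfderiv_comp y (hι (f (c y))) (hf.comp y hc), mfderiv_comp y hf hc,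
      mfderiv_eq_fderiv] at e
    exact DFunLike.congr_fun e v
  simp only [chain]
  have : ∀ (P : Matrix.GeneralLinearGroup (Fin L) ℝ)
      (w : TangentSpace 𝓘(ℝ, Fin L → Fin L → ℝ) P), glForm L i j P (fun _ => w)
      = ∑ q, P⁻¹ i q * (show ℝ from mfderiv 𝓘(ℝ, Fin L → Fin L → ℝ) 𝓘(ℝ, ℝ)
        (fun z : Matrix.GeneralLinearGroup (Fin L) ℝ => z q j) P w) := by
    intro P w
    simp only [glForm, Matrix.of_apply, ContinuousAlternatingMap.sum_apply]
    rfl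
  exact this _ _

end MaurerCartan

theorem corollary5p1
    {L m n : ℕ}
    -- a `C^2` manifold of dimension `m`
    {M : Type*} [TopologicalSpace M] [ChartedSpace (EuclideanSpace ℝ (Fin m)) M]
    [IsManifold (𝓡 m) 2 M]
    -- a Lie subgroup `G` of `GL(L, ℝ)` with inclusion `ι`
    {G : Type*} [TopologicalSpace G] [ChartedSpace (EuclideanSpace ℝ (Fin n)) G] [Group G]
    [LieGroup (𝓡 n) ∞ G]
    (ι : G →* Matrix.GeneralLinearGroup (Fin L) ℝ) (hι : MaurerCartan.IsLieSubgroupInclusion n ι)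
    -- a matrix-valued `1`-form of class `C^1`
    (φ : MaurerCartan.MatForm L (EuclideanSpace ℝ (Fin m)) M 1) (hφ : φ.IsOfClass 1)
    -- a `C^1` map from the open set `U` to `G` (its values outside `U` are irrelevant)
    (U : Set M) (hU : IsOpen U) (f : M → G) (hf : ContMDiffOn (𝓡 m) (𝓡 n) 1 f U)
    (Q : M) (hQU : Q ∈ U)
    (hQ : MaurerCartan.IsDensityPoint m ((m : ℝ) + 1)
      {P : M | P ∈ U ∧
        ((MaurerCartan.maurerCartanForm n ι).pullback f :
          MaurerCartan.MatForm L (EuclideanSpace ℝ (Fin m)) M 1).valueAt P = φ.valueAt P} Q) :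
    φ.d.valueAt Q = -(φ.wedge φ).valueAt Q := by
  have _ : IsManifold (𝓡 m) 1 M := .of_le (n := 2) (by norm_num)
  -- The chart in which `d` is computed at `Q`; it may differ from the one witnessing the density
  -- hypothesis. As a `C²` chart it also gives `C¹` local representatives of `φ`.
  set c := chartAt (EuclideanSpace ℝ (Fin m)) Q with hc
  have hQc : Q ∈ c.source := mem_chart_source _ Q
  have hc2 : c ∈ IsManifold.maximalAtlas (𝓡 m) (1 + 1) M := by
    rw [one_add_one_eq_two]
    exact IsManifold.chart_mem_maximalAtlas Q
  have hc1 : c ∈ IsManifold.maximalAtlas (𝓡 m) 1 M := IsManifold.chart_mem_maximalAtlas Q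
  have hcd : c.MDifferentiable (𝓡 m) (𝓡 m) := mdifferentiable_chart Q
  set V := c.target ∩ c.symm ⁻¹' U with hV
  have hVo : IsOpen V := c.symm.isOpen_inter_preimage hU
  have hxV : c Q ∈ V := ⟨c.map_source hQc, by simpa [hQc] using hQU⟩
  have hz : ∀ i j, ContDiffOn ℝ 1 (fun y => ι (f (c.symm y)) i j) V := by
    intro i j
    have h1 : ContMDiff (𝓡 n) 𝓘(ℝ, ℝ) 1 (fun g : G => ι g i j) :=
      ((MaurerCartan.contMDiff_entry i j).comp hι.contMDiff).of_le (by norm_num)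
    exact (h1.comp_contMDiffOn (hf.comp ((contMDiffOn_symm_of_mem_maximalAtlas hc1).mono
      Set.inter_subset_left) Set.inter_subset_right)).contDiffOn
  have hψ : ∀ i j, ContDiffOn ℝ 1 ((φ i j).localFunctional c) V := fun i j =>
    (ContinuousAlternatingMap.ofSubsingletonLIE (𝕜 := ℝ) (E := EuclideanSpace ℝ (Fin m))
      (F := ℝ) (0 : Fin 1)).symm.contDiff.comp_contDiffOn
        ((hφ i j c hc2).mono Set.inter_subset_left)
  have main := MaurerCartan.structure_equation_of_superdense MeasureTheory.volume hVo hxV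
    (z := fun y => ι (f (c.symm y))) hz (ψ := fun i j => (φ i j).localFunctional c) hψ ?_
    (hQ.superdense_image_chart hc1 hQc)
  · refine Matrix.ext fun i j => ContinuousAlternatingMap.ext fun v => ?_
    have hd : DifferentiableAt ℝ ((φ i j).localRep c) (c Q) :=
      ((hφ i j c hc2).contDiffAt (c.open_target.mem_nhds (c.map_source hQc))).differentiableAt
        (by norm_num)
    have e := main (mfderiv (𝓡 m) (𝓡 m) c Q (v 0)) (mfderiv (𝓡 m) (𝓡 m) c Q (v 1)) i j
    rw [← MaurerCartan.DiffForm.d_apply (φ i j) Q hd v] at e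
    simp only [MaurerCartan.DiffForm.localFunctional_mfderiv _ hcd hQc] at e
    refine e.trans ?_
    simp only [MaurerCartan.MatForm.valueAt, MaurerCartan.MatForm.wedge, Matrix.neg_apply,
      Matrix.of_apply, Finset.sum_apply, ContinuousAlternatingMap.neg_apply,
      ContinuousAlternatingMap.sum_apply]
    rfl
  -- On the image of the coincidence set, `φ = f^* Γ_G` pulled back by `c.symm` reads `ψ = z⁻¹ dz`.
  · rintro _ ⟨P, ⟨⟨hPU, hP⟩, hPc⟩, rfl⟩ i j
    ext v
    have hPs : c.symm (c P) = P := c.left_inv hPc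
    have hval := congrFun (congrFun hP i) j
    rw [← hPs] at hval hPU
    rw [_root_.sum_apply]
    have hfd : MDifferentiableAt (𝓡 m) (𝓡 n) f (c.symm (c P)) :=
      (hf.contMDiffAt (hU.mem_nhds hPU)).mdifferentiableAt (by norm_num)
    have hsd : MDifferentiableAt (𝓡 m) (𝓡 m) c.symm (c P) :=
      hcd.mdifferentiableAt_symm (c.map_source hPc)
    have := MaurerCartan.pullback_maurerCartanForm_apply
      (hι.contMDiff.mdifferentiable (by simp)) hfd hsd i j v
    exact (DFunLike.congr_fun hval _).symm.trans this
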